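/- Let $G=\langle S,T\mid STS=T^{-1}ST^{-1}\rangle$. Let $\widetilde{\mathrm{SL}}_2(\mathbb R)$ be the universal cover of $\mathrm{SL}_2(\mathbb R)$, that is, the group of homotopy classes, relative to the endpoints, of continuous paths $[0,1]\to\mathrm{SL}_2(\mathbb R)$ starting at the identity, with multiplication induced by pointwise multiplication of paths and with the projection to $\mathrm{SL}_2(\mathbb R)$ that sends the class of a path to its endpoint. Let $G'\subseteq\widetilde{\mathrm{SL}}_2(\mathbb R)$ be the preimage of $\mathrm{SL}_2(\mathbb Z)$ under this projection. Then $G$ is isomorphic to $G'$. More precisely, there is a group isomorphism $\phi\colon G\to G'$ such that $$\phi(S)=\left[\begin{pmatrix}\cos\frac{\pi t}{2}&-\sin\frac{\pi t}{2}\\ \sin\frac{\pi t}{2}&\cos\frac{\pi t}{2}\end{pmatrix}\right]_{0\le t\le 1},\qquad \phi(T)=\left[\begin{pmatrix}1&t\\0&1\end{pmatrix}\right]_{0\le t\le 1}.$$ -/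

import Mathlib

open scoped unitInterval MatrixGroups

/-- The two generator symbols of the group `G`. -/
inductive Gen : Type
  | S : Gen
  | T : Gen

/-- The defining relation `S T S = T⁻¹ S T⁻¹`, as the single relator
`S T S (T⁻¹ S T⁻¹)⁻¹` in the free group on `S, T`. -/
def relatorsG : Set (FreeGroup Gen) :=
  {FreeGroup.of Gen.S * FreeGroup.of Gen.T * FreeGroup.of Gen.S *
    ((FreeGroup.of Gen.T)⁻¹ * FreeGroup.of Gen.S * (FreeGroup.of Gen.T)⁻¹)⁻¹}

/-- The group `G = ⟨S, T ∣ S T S = T⁻¹ S T⁻¹⟩`. -/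
abbrev GroupG : Type := PresentedGroup relatorsG

/-- The paths `[0,1] → H` that start at the identity, a group under pointwise multiplication. -/
def basedPaths (H : Type*) [Group H] [TopologicalSpace H] [IsTopologicalGroup H] :
    Subgroup C(I, H) where
  carrier := {γ | γ 0 = 1}
  one_mem' := rfl
  mul_mem' := by
    intro a b ha hb
    simp only [Set.mem_ofPred_eq] at ha hb ⊢
    simp [ha, hb]
  inv_mem' := by
    intro a ha
    simp only [Set.mem_ofPred_eq] at ha ⊢
    simp [ha]

/-- Homotopy of based paths relative to both endpoints. It is compatible with the pointwise
product. -/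
def basedPathsCon (H : Type*) [Group H] [TopologicalSpace H] [IsTopologicalGroup H] :
    Con (basedPaths H) where
  r γ δ := ContinuousMap.HomotopicRel (γ : C(I, H)) (δ : C(I, H)) {0, 1}
  iseqv :=
    { refl := fun γ => ContinuousMap.HomotopicRel.refl _
      symm := fun h => h.symm
      trans := fun h h' => h.trans h' }
  mul' := by
    rintro a b c d ⟨F⟩ ⟨F'⟩
    exact ⟨{
      toFun := fun x => F x * F' x
      continuous_toFun := F.continuous.mul F'.continuous
      map_zero_left := fun x => by simp
      map_one_left := fun x => by simp
      prop' := fun t x hx => by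
        have h1 := F.eq_fst t hx
        have h2 := F'.eq_fst t hx
        simp [h1, h2] }⟩

/-- The group of homotopy classes, relative to the endpoints, of paths in `H` starting at the
identity, with pointwise multiplication. For `H` path connected, locally path connected and
semilocally simply connected (in particular for a connected Lie group) this is the standard
construction of the universal covering group of `H`. -/
abbrev UniversalCover (H : Type*) [Group H] [TopologicalSpace H] [IsTopologicalGroup H] :=
  (basedPathsCon H).Quotient

/-- The covering projection: the class of a path is sent to the end point of the path. -/
def UniversalCover.proj (H : Type*) [Group H] [TopologicalSpace H] [IsTopologicalGroup H] :
    UniversalCover H →* H :=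
  (basedPathsCon H).lift
    { toFun := fun γ => (γ : C(I, H)) 1
      map_one' := rfl
      map_mul' := fun _ _ => rfl }
    (by
      rintro γ δ ⟨F⟩
      exact F.fst_eq_snd (by simp))

/-- The preimage of `SL₂(ℤ) ⊆ SL₂(ℝ)` in the universal cover of `SL₂(ℝ)`. -/
def preimageSL2Z : Subgroup (UniversalCover SL(2, ℝ)) :=
  (Matrix.SpecialLinearGroup.map (n := Fin 2) (Int.castRingHom ℝ)).range.comap
    (UniversalCover.proj SL(2, ℝ))

/-- The rotation of the plane by the angle `π t / 2`. -/
noncomputable def rotationMatrix (t : ℝ) : SL(2, ℝ) :=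
  ⟨!![Real.cos (Real.pi * t / 2), -Real.sin (Real.pi * t / 2);
      Real.sin (Real.pi * t / 2), Real.cos (Real.pi * t / 2)], by
    rw [Matrix.det_fin_two_of]
    nlinarith [Real.sin_sq_add_cos_sq (Real.pi * t / 2)]⟩

/-- The shear with upper right entry `t`. -/
def shearMatrix (t : ℝ) : SL(2, ℝ) :=
  ⟨!![1, t; 0, 1], by simp [Matrix.det_fin_two_of]⟩

/-- The path `t ↦ rotationMatrix t`, for `0 ≤ t ≤ 1`. -/
noncomputable def rotationPath : basedPaths SL(2, ℝ) :=
  ⟨{ toFun := fun t => rotationMatrix t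
     continuous_toFun := by
      refine Continuous.subtype_mk (continuous_matrix fun i j => ?_) _
      fin_cases i <;> fin_cases j <;> simp <;> fun_prop }, by
    change rotationMatrix ((0 : I) : ℝ) = 1
    ext i j
    fin_cases i <;> fin_cases j <;> simp [rotationMatrix]⟩

/-- The path `t ↦ shearMatrix t`, for `0 ≤ t ≤ 1`. -/
noncomputable def shearPath : basedPaths SL(2, ℝ) :=
  ⟨{ toFun := fun t => shearMatrix t
     continuous_toFun := by
      refine Continuous.subtype_mk (continuous_matrix fun i j => ?_) _
      fin_cases i <;> fin_cases j <;> simp <;> fun_prop }, by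
    change shearMatrix ((0 : I) : ℝ) = 1
    ext i j
    fin_cases i <;> fin_cases j <;> simp [shearMatrix]⟩

/-!
Read the first column of a matrix in `SL₂(ℝ)` as a nonzero complex number. The first column of a
path starting at the identity has a unique continuous logarithm starting at `0`, because
`exp : ℂ → ℂ \ {0}` is a covering map. The value of this logarithm at the end of the path is a
homotopy invariant (`IsLogLift.apply_one_eq`), and together with the end point of the path it is a
complete one (`IsLogLift.homotopicRel`): a matrix is determined by a logarithm of its first column
and one further real coordinate, so lifted paths live in the vector space `ℂ × ℝ`, where straight
line homotopies are available. All questions about the universal cover reduce to computing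
logarithms at end points.

* The two sides of `S T S = T⁻¹ S T⁻¹` have the same end point and the same final logarithm, so `G`
  maps to the universal cover (`toUniversalCover`).
* The path `S ^ n` is the rotation by `π n t / 2`. A loop has final logarithm `2 π i m`, hence is
  the class of `S ^ (4 m)`. As `SL₂(ℤ)` is generated by the images of `S` and `T`, the image of `G`
  is the whole preimage of `SL₂(ℤ)` (`range_toUniversalCover`).
* Put `U = T S`. The relation says `U ^ 3 = S ^ 2`, so `S ^ 2` is central, and modulo `S ^ 2` every
  word alternates between `S` and `U` or `U ^ 2`. Since `U S⁻¹ = T` and `U ^ 2 S⁻¹ = T S T`, every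
  element has the form `S ^ (2 k) * S ^ ε * w * U ^ j` with `w` a product of copies of `T` and
  `T S T` (`isNormalForm`). Both `T` and `T S T` map to matrices with nonnegative entries, and a
  comparison of signs shows that such an element maps to the identity matrix only if it is
  `S ^ (2 k)` (`exists_eq_genS_sq_zpow`). The path of `S ^ (2 k)` has final logarithm `π i k`, so
  it is trivial in the universal cover only for `k = 0` (`toUniversalCover_injective`).
-/

/-! ### Logarithms of the first column -/

/-- The first column of a real `2 × 2` matrix, as a complex number. -/
def firstColumn (M : SL(2, ℝ)) : ℂ := ⟨M 0 0, M 1 0⟩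

theorem firstColumn_ne_zero (M : SL(2, ℝ)) : firstColumn M ≠ 0 := by
  intro h
  have h0 : M 0 0 = 0 := congrArg Complex.re h
  have h1 : M 1 0 = 0 := congrArg Complex.im h
  have hdet := M.det_coe
  rw [Matrix.det_fin_two, h0, h1] at hdet
  simp at hdet

theorem continuous_firstColumn : Continuous firstColumn := by
  have h : ∀ i j, Continuous fun M : SL(2, ℝ) => M i j := fun i j =>
    (continuous_apply_apply i j).comp continuous_subtype_val
  have : firstColumn = fun M : SL(2, ℝ) => (M 0 0 : ℂ) + (M 1 0 : ℂ) * Complex.I := by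
    funext M
    apply Complex.ext <;> simp [firstColumn]
  rw [this]
  exact (Complex.continuous_ofReal.comp (h 0 0)).add
    ((Complex.continuous_ofReal.comp (h 1 0)).mul continuous_const)

/-- The path `L` in `ℂ` is the logarithm, starting at `0`, of the first column of the path `γ`. -/
def IsLogLift (γ : C(I, SL(2, ℝ))) (L : C(I, ℂ)) : Prop :=
  L 0 = 0 ∧ ∀ t, Complex.exp (L t) = firstColumn (γ t)

/-- The first column, as a continuous map to the punctured plane. -/
def firstColumnPath : C(SL(2, ℝ), {z : ℂ // z ≠ 0}) :=
  ⟨fun M => ⟨firstColumn M, firstColumn_ne_zero M⟩, continuous_firstColumn.subtype_mk _⟩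

theorem firstColumn_one : firstColumn 1 = 1 := by
  apply Complex.ext <;> simp [firstColumn]

theorem exists_isLogLift {γ : C(I, SL(2, ℝ))} (hγ : γ 0 = 1) : ∃ L, IsLogLift γ L := by
  obtain ⟨L, hL, hL0⟩ := Complex.isCoveringMap_exp.exists_path_lifts
    (firstColumnPath.comp γ) 0 (Subtype.ext (by simp [firstColumnPath, hγ, firstColumn_one]))
  exact ⟨L, hL0, fun t => congrArg Subtype.val (congrFun hL t)⟩

/-- Lifting of homotopies: the logarithm at the end point depends on the homotopy class only. -/
theorem IsLogLift.apply_one_eq {γ δ : C(I, SL(2, ℝ))} {L M : C(I, ℂ)} (hL : IsLogLift γ L)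
    (hM : IsLogLift δ M) (h : γ.HomotopicRel δ {0, 1}) : L 1 = M 1 := by
  have h' : (firstColumnPath.comp γ).HomotopicRel (firstColumnPath.comp δ) {0, 1} :=
    h.comp_continuousMap firstColumnPath
  have hL' : (fun z : ℂ => (⟨_, z.exp_ne_zero⟩ : {z : ℂ // z ≠ 0})) ∘ L =
    firstColumnPath.comp γ := funext fun t => Subtype.ext (hL.2 t)
  have hM' : (fun z : ℂ => (⟨_, z.exp_ne_zero⟩ : {z : ℂ // z ≠ 0})) ∘ M =
    firstColumnPath.comp δ := funext fun t => Subtype.ext (hM.2 t)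
  have key := Complex.isCoveringMap_exp.liftPath_apply_one_eq_of_homotopicRel h' 0
    (by rw [← hL', Function.comp_apply, hL.1]) (by rw [← hM', Function.comp_apply, hM.1])
  rwa [← (Complex.isCoveringMap_exp.eq_liftPath_iff' ..).2 ⟨hL', hL.1⟩,
    ← (Complex.isCoveringMap_exp.eq_liftPath_iff' ..).2 ⟨hM', hM.1⟩] at key

/-! ### Homotopies between paths with equal logarithms -/

/-- The matrix with first column `c = exp z` and second column `c (x + i / |c|²)`. The imaginary part
of the second factor is forced by the determinant, so `chart` maps `ℂ × ℝ` onto `SL₂(ℝ)`. -/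
noncomputable def chart (z : ℂ) (x : ℝ) : SL(2, ℝ) :=
  ⟨!![(Complex.exp z).re, (Complex.exp z * ⟨x, Real.exp (-2 * z.re)⟩).re;
      (Complex.exp z).im, (Complex.exp z * ⟨x, Real.exp (-2 * z.re)⟩).im], by
    have h : (Complex.exp z).re ^ 2 + (Complex.exp z).im ^ 2 = Real.exp (2 * z.re) := by
      rw [two_mul, Real.exp_add, ← Complex.norm_exp, ← sq, ← Complex.normSq_eq_norm_sq,
        Complex.normSq_apply]
      ring
    have h' : Real.exp (2 * z.re) * Real.exp (-2 * z.re) = 1 := by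
      rw [← Real.exp_add]
      simp
    rw [Matrix.det_fin_two_of, Complex.mul_re, Complex.mul_im]
    linear_combination Real.exp (-2 * z.re) * h + h'⟩

theorem continuous_chart : Continuous fun p : ℂ × ℝ => chart p.1 p.2 := by
  have hc : Continuous fun p : ℂ × ℝ => (⟨p.2, Real.exp (-2 * p.1.re)⟩ : ℂ) :=
    Complex.equivRealProdCLM.symm.continuous.comp
      (by fun_prop : Continuous fun p : ℂ × ℝ => (p.2, Real.exp (-2 * p.1.re)))
  refine Continuous.subtype_mk (continuous_matrix fun i j => ?_) _
  fin_cases i <;> fin_cases j <;>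
    simp only [Matrix.of_apply, Matrix.cons_val', Fin.zero_eta, Fin.mk_one, Matrix.cons_val_zero,
      Matrix.cons_val_one, Matrix.cons_val_fin_one] <;>
    fun_prop

/-- The coordinate `x` of the matrix `chart z x`: the real part of the quotient of the second
column by the first, as complex numbers. -/
noncomputable def shearCoordinate (M : SL(2, ℝ)) : ℝ :=
  (M 0 0 * M 0 1 + M 1 0 * M 1 1) / (M 0 0 ^ 2 + M 1 0 ^ 2)

theorem sq_add_sq_pos (M : SL(2, ℝ)) : 0 < M 0 0 ^ 2 + M 1 0 ^ 2 := by
  have h := Complex.normSq_pos.2 (firstColumn_ne_zero M)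
  rw [Complex.normSq_apply] at h
  simpa [firstColumn, sq] using h

theorem continuous_shearCoordinate : Continuous shearCoordinate := by
  have h : ∀ i j, Continuous fun M : SL(2, ℝ) => M i j := fun i j =>
    (continuous_apply_apply i j).comp continuous_subtype_val
  exact (((h 0 0).mul (h 0 1)).add ((h 1 0).mul (h 1 1))).div
    (((h 0 0).pow 2).add ((h 1 0).pow 2)) fun M => (sq_add_sq_pos M).ne'

theorem chart_shearCoordinate {z : ℂ} {M : SL(2, ℝ)} (h : Complex.exp z = firstColumn M) :
    chart z (shearCoordinate M) = M := by
  have hpos := sq_add_sq_pos M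
  have hdet := M.det_coe
  rw [Matrix.det_fin_two] at hdet
  have hexp : Real.exp (-2 * z.re) = (M 0 0 ^ 2 + M 1 0 ^ 2)⁻¹ := by
    have h1 : Real.exp (2 * z.re) = M 0 0 ^ 2 + M 1 0 ^ 2 := by
      rw [two_mul, Real.exp_add, ← Complex.norm_exp, ← sq, ← Complex.normSq_eq_norm_sq,
        Complex.normSq_apply, h]
      simp [firstColumn, sq]
    rw [← h1, ← Real.exp_neg]
    ring_nf
  ext i j
  fin_cases i <;> fin_cases j
  · simp [chart, h, firstColumn]
  · simp only [chart, h, firstColumn, hexp, shearCoordinate]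
    simp
    field_simp
    linear_combination (M 1 0) * hdet
  · simp [chart, h, firstColumn]
  · simp only [chart, h, firstColumn, hexp, shearCoordinate]
    simp
    field_simp
    linear_combination (-M 0 0) * hdet

/-- Two based paths with the same end point and the same logarithm at the end point are
homotopic: in the coordinates of `chart` they are paths in a vector space, and the straight
line homotopy works. -/
theorem IsLogLift.homotopicRel {γ δ : C(I, SL(2, ℝ))} {L M : C(I, ℂ)} (hL : IsLogLift γ L)
    (hM : IsLogLift δ M) (h0 : γ 0 = δ 0) (h1 : γ 1 = δ 1) (h : L 1 = M 1) :
    γ.HomotopicRel δ {0, 1} := by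
  refine ⟨{
    toFun := fun p => chart ((1 - (p.1 : ℝ) : ℝ) * L p.2 + ((p.1 : ℝ) : ℂ) * M p.2)
      ((1 - (p.1 : ℝ)) * shearCoordinate (γ p.2) + p.1 * shearCoordinate (δ p.2))
    continuous_toFun := ?_
    map_zero_left := fun t => ?_
    map_one_left := fun t => ?_
    prop' := ?_ }⟩
  · have := continuous_shearCoordinate
    exact continuous_chart.comp (by fun_prop : Continuous fun p : I × I =>
      (((1 - (p.1 : ℝ) : ℝ) * L p.2 + ((p.1 : ℝ) : ℂ) * M p.2 : ℂ),
        ((1 - (p.1 : ℝ)) * shearCoordinate (γ p.2) + p.1 * shearCoordinate (δ p.2) : ℝ)))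
  · simpa using chart_shearCoordinate (hL.2 t)
  · simpa using chart_shearCoordinate (hM.2 t)
  · intro s t ht
    have hLM : L t = M t ∧ γ t = δ t := by
      rcases ht with rfl | rfl
      · exact ⟨hL.1.trans hM.1.symm, h0⟩
      · exact ⟨h, h1⟩
    have e1 : ((1 - (s : ℝ) : ℝ) * L t + ((s : ℝ) : ℂ) * M t : ℂ) = L t := by
      rw [hLM.1]; push_cast; ring
    have e2 : (1 - (s : ℝ)) * shearCoordinate (γ t) + s * shearCoordinate (δ t) =
        shearCoordinate (γ t) := by
      rw [hLM.2]; ring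
    change chart ((1 - (s : ℝ) : ℝ) * L t + ((s : ℝ) : ℂ) * M t)
      ((1 - (s : ℝ)) * shearCoordinate (γ t) + s * shearCoordinate (δ t)) = γ t
    rw [e1, e2, chart_shearCoordinate (hL.2 t)]

/-! ### Powers of the rotation path -/

theorem specialLinearGroup_mul_apply (A B : SL(2, ℝ)) (i j : Fin 2) :
    (A * B) i j = A i 0 * B 0 j + A i 1 * B 1 j := by
  rw [Matrix.SpecialLinearGroup.coe_mul, Matrix.mul_apply, Fin.sum_univ_two]

theorem rotationMatrix_add (a b : ℝ) :
    rotationMatrix (a + b) = rotationMatrix a * rotationMatrix b := by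
  have h : Real.pi * (a + b) / 2 = Real.pi * a / 2 + Real.pi * b / 2 := by ring
  ext i j
  rw [specialLinearGroup_mul_apply]
  fin_cases i <;> fin_cases j <;>
    simp [rotationMatrix, h, Real.cos_add, Real.sin_add] <;> ring

/-- Rotations, as a one-parameter group. -/
noncomputable def rotationHom : Multiplicative ℝ →* SL(2, ℝ) :=
  MonoidHom.mk' (fun t => rotationMatrix t.toAdd) fun _ _ => rotationMatrix_add _ _

theorem rotationMatrix_zpow (t : ℝ) (n : ℤ) : rotationMatrix t ^ n = rotationMatrix (n * t) := by
  have := map_zpow rotationHom (Multiplicative.ofAdd t) n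
  rw [← ofAdd_zsmul, zsmul_eq_mul] at this
  exact this.symm

theorem rotationPath_zpow_apply (n : ℤ) (t : I) :
    ((rotationPath ^ n : basedPaths SL(2, ℝ)) : C(I, SL(2, ℝ))) t = rotationMatrix (n * t) := by
  let ev : basedPaths SL(2, ℝ) →* SL(2, ℝ) :=
    { toFun := fun γ => (γ : C(I, SL(2, ℝ))) t
      map_one' := rfl
      map_mul' := fun _ _ => rfl }
  exact (map_zpow ev rotationPath n).trans (rotationMatrix_zpow t n)

theorem firstColumn_rotationMatrix (t : ℝ) :
    firstColumn (rotationMatrix t) = Complex.exp ((Real.pi * t / 2 : ℝ) * Complex.I) := by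
  apply Complex.ext <;> simp only [Complex.exp_ofReal_mul_I_re, Complex.exp_ofReal_mul_I_im] <;>
    simp [firstColumn, rotationMatrix]

theorem isLogLift_rotationPath_zpow (n : ℤ) :
    IsLogLift ((rotationPath ^ n : basedPaths SL(2, ℝ)) : C(I, SL(2, ℝ)))
      ⟨fun t => (Real.pi * (n * t) / 2 : ℝ) * Complex.I, by fun_prop⟩ :=
  ⟨by simp, fun t => by
    rw [rotationPath_zpow_apply, firstColumn_rotationMatrix]
    rfl⟩

/-! ### The defining relation holds in the universal cover -/

theorem shearMatrix_inv (t : ℝ) : (shearMatrix t)⁻¹ = shearMatrix (-t) := by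
  rw [inv_eq_iff_mul_eq_one]
  ext i j
  rw [specialLinearGroup_mul_apply]
  fin_cases i <;> fin_cases j <;> simp [shearMatrix]

theorem firstColumn_rotationMatrix_mul (t : ℝ) (M : SL(2, ℝ)) :
    firstColumn (rotationMatrix t * M) =
      Complex.exp ((Real.pi * t / 2 : ℝ) * Complex.I) * firstColumn M := by
  apply Complex.ext <;>
    simp only [Complex.mul_re, Complex.mul_im, Complex.exp_ofReal_mul_I_re,
      Complex.exp_ofReal_mul_I_im, firstColumn, specialLinearGroup_mul_apply] <;>
    simp [rotationMatrix] <;> ring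

theorem firstColumn_shearMatrix_mul_rotationMatrix (s t : ℝ) :
    firstColumn (shearMatrix s * rotationMatrix t) =
      ⟨Real.cos (Real.pi * t / 2) + s * Real.sin (Real.pi * t / 2),
        Real.sin (Real.pi * t / 2)⟩ := by
  apply Complex.ext <;> simp only [firstColumn, specialLinearGroup_mul_apply] <;>
    simp [rotationMatrix, shearMatrix]

theorem firstColumn_mul_shearMatrix (M : SL(2, ℝ)) (t : ℝ) :
    firstColumn (M * shearMatrix t) = firstColumn M := by
  apply Complex.ext <;> simp only [firstColumn, specialLinearGroup_mul_apply] <;>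
    simp [shearMatrix]

/-- On the first quarter turn a shear keeps the rotated first basis vector off the closed negative
real axis, so its principal logarithm varies continuously. -/
theorem firstColumn_shearMatrix_mul_rotationMatrix_mem_slitPlane (s : ℝ) (t : I) :
    firstColumn (shearMatrix s * rotationMatrix t) ∈ Complex.slitPlane := by
  rw [firstColumn_shearMatrix_mul_rotationMatrix]
  rcases t.2.1.eq_or_lt with h | h
  · left
    simp [← h]
  · right
    refine (Real.sin_pos_of_pos_of_lt_pi (by positivity) ?_).ne'
    nlinarith [Real.pi_pos, t.2.2]

theorem rotationMatrix_zero : rotationMatrix 0 = 1 := by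
  simpa using (rotationMatrix_zpow 0 0).symm

theorem shearMatrix_zero : shearMatrix 0 = 1 := by
  ext i j
  fin_cases i <;> fin_cases j <;> simp [shearMatrix]

theorem continuous_shearMatrix : Continuous shearMatrix := by
  refine Continuous.subtype_mk (continuous_matrix fun i j => ?_) _
  fin_cases i <;> fin_cases j <;> simp <;> fun_prop

theorem continuous_rotationMatrix : Continuous rotationMatrix := by
  refine Continuous.subtype_mk (continuous_matrix fun i j => ?_) _
  fin_cases i <;> fin_cases j <;> simp <;> fun_prop

theorem continuous_log_firstColumn {s : I → ℝ} (hs : Continuous s) : Continuous fun t : I =>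
    Complex.log (firstColumn (shearMatrix (s t) * rotationMatrix t)) :=
  (continuous_firstColumn.comp ((continuous_shearMatrix.comp hs).mul
    (continuous_rotationMatrix.comp continuous_subtype_val))).clog
      fun t => firstColumn_shearMatrix_mul_rotationMatrix_mem_slitPlane (s t) t

theorem exists_isLogLift_rotationPath_shearPath_rotationPath :
    ∃ L, IsLogLift ((rotationPath * shearPath * rotationPath : basedPaths SL(2, ℝ)) :
      C(I, SL(2, ℝ))) L ∧ L 1 = (Real.pi / 2 : ℝ) * Complex.I + Complex.log (1 + Complex.I) := by
  have hc := continuous_log_firstColumn (s := fun t => t) continuous_subtype_val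
  refine ⟨⟨fun t => (Real.pi * t / 2 : ℝ) * Complex.I +
    Complex.log (firstColumn (shearMatrix t * rotationMatrix t)), by fun_prop⟩,
    ⟨?_, fun t => ?_⟩, ?_⟩
  · simp [rotationMatrix_zero, shearMatrix_zero, firstColumn_one]
  · change Complex.exp (_ + _) = firstColumn (rotationMatrix t * shearMatrix t * rotationMatrix t)
    rw [Complex.exp_add, Complex.exp_log (firstColumn_ne_zero _), mul_assoc,
      firstColumn_rotationMatrix_mul]
  · have : firstColumn (shearMatrix 1 * rotationMatrix 1) = 1 + Complex.I := by
      rw [firstColumn_shearMatrix_mul_rotationMatrix]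
      apply Complex.ext <;> simp
    simp [this]

theorem exists_isLogLift_shearPath_inv_rotationPath_shearPath_inv :
    ∃ L, IsLogLift ((shearPath⁻¹ * rotationPath * shearPath⁻¹ : basedPaths SL(2, ℝ)) :
      C(I, SL(2, ℝ))) L ∧ L 1 = Complex.log (-1 + Complex.I) := by
  refine ⟨⟨_, continuous_log_firstColumn (s := fun t => -(t : ℝ)) (by fun_prop)⟩,
    ⟨?_, fun t => ?_⟩, ?_⟩
  · simp [rotationMatrix_zero, shearMatrix_zero, firstColumn_one]
  · change Complex.exp (Complex.log _) =
      firstColumn ((shearMatrix t)⁻¹ * rotationMatrix t * (shearMatrix t)⁻¹)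
    rw [Complex.exp_log (firstColumn_ne_zero _), shearMatrix_inv, firstColumn_mul_shearMatrix]
  · have : firstColumn (shearMatrix (-1) * rotationMatrix 1) = -1 + Complex.I := by
      rw [firstColumn_shearMatrix_mul_rotationMatrix]
      apply Complex.ext <;> simp
    simp [this]

theorem log_neg_one_add_I :
    Complex.log (-1 + Complex.I) =
      (Real.pi / 2 : ℝ) * Complex.I + Complex.log (1 + Complex.I) := by
  have h0 : (1 + Complex.I) ≠ 0 := fun h => by simpa using congrArg Complex.re h
  have harg : |Complex.arg (1 + Complex.I)| < Real.pi / 2 :=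
    Complex.abs_arg_lt_pi_div_two_iff.2 (by simp)
  rw [abs_lt] at harg
  have := (Complex.log_mul_eq_add_log_iff Complex.I_ne_zero h0).2 (by
    rw [Complex.arg_I]
    constructor <;> linarith [Real.pi_pos])
  rw [Complex.log_I] at this
  rw [Complex.ofReal_div, Complex.ofReal_ofNat, ← this]
  congr 1
  apply Complex.ext <;> simp

theorem rotationMatrix_one_apply : ((rotationMatrix 1 : SL(2, ℝ)) : Matrix (Fin 2) (Fin 2) ℝ) =
    !![0, -1; 1, 0] := by
  simp [rotationMatrix]

theorem homotopicRel_rotationPath_shearPath :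
    ((rotationPath * shearPath * rotationPath : basedPaths SL(2, ℝ)) : C(I, SL(2, ℝ))).HomotopicRel
      (shearPath⁻¹ * rotationPath * shearPath⁻¹ : basedPaths SL(2, ℝ)) {0, 1} := by
  obtain ⟨L, hL, hL1⟩ := exists_isLogLift_rotationPath_shearPath_rotationPath
  obtain ⟨M, hM, hM1⟩ := exists_isLogLift_shearPath_inv_rotationPath_shearPath_inv
  refine hL.homotopicRel hM ?_ ?_ (by rw [hL1, hM1, log_neg_one_add_I])
  · exact (Subtype.property (rotationPath * shearPath * rotationPath)).trans
      (Subtype.property (shearPath⁻¹ * rotationPath * shearPath⁻¹)).symm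
  · change rotationMatrix 1 * shearMatrix 1 * rotationMatrix 1 =
      (shearMatrix 1)⁻¹ * rotationMatrix 1 * (shearMatrix 1)⁻¹
    rw [shearMatrix_inv]
    ext i j
    simp only [specialLinearGroup_mul_apply, rotationMatrix_one_apply]
    fin_cases i <;> fin_cases j <;> simp [shearMatrix]

/-! ### The homomorphism to the universal cover -/

/-- The values of the homomorphism on the generators. -/
noncomputable def genImage : Gen → UniversalCover SL(2, ℝ)
  | Gen.S => (basedPathsCon SL(2, ℝ)).mk' rotationPath
  | Gen.T => (basedPathsCon SL(2, ℝ)).mk' shearPath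

theorem lift_genImage_eq_one : ∀ r ∈ relatorsG, FreeGroup.lift genImage r = 1 := by
  rintro r rfl
  have : (basedPathsCon SL(2, ℝ)).mk' (rotationPath * shearPath * rotationPath) =
      (basedPathsCon SL(2, ℝ)).mk' (shearPath⁻¹ * rotationPath * shearPath⁻¹) :=
    (Con.eq _).2 homotopicRel_rotationPath_shearPath
  simp only [map_mul, map_inv] at this
  simp only [map_mul, map_inv, FreeGroup.lift_apply_of, genImage]
  rw [this, mul_inv_cancel]

/-- The homomorphism from `G` to the universal cover. -/
noncomputable def toUniversalCover : GroupG →* UniversalCover SL(2, ℝ) :=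
  PresentedGroup.toGroup lift_genImage_eq_one

/-- The homomorphism from `G` to `SL₂(ℝ)`. -/
noncomputable def toSL2R : GroupG →* SL(2, ℝ) :=
  (UniversalCover.proj SL(2, ℝ)).comp toUniversalCover

/-- The generator `S` of `G`. -/
def genS : GroupG := PresentedGroup.of Gen.S

/-- The generator `T` of `G`. -/
def genT : GroupG := PresentedGroup.of Gen.T

theorem toUniversalCover_genS :
    toUniversalCover genS = (basedPathsCon SL(2, ℝ)).mk' rotationPath :=
  PresentedGroup.toGroup.of lift_genImage_eq_one

theorem toUniversalCover_genT :
    toUniversalCover genT = (basedPathsCon SL(2, ℝ)).mk' shearPath :=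
  PresentedGroup.toGroup.of lift_genImage_eq_one

theorem toSL2R_genS : toSL2R genS = rotationMatrix 1 := by
  simp only [toSL2R, MonoidHom.comp_apply, toUniversalCover_genS]
  rfl

theorem toSL2R_genT : toSL2R genT = shearMatrix 1 := by
  simp only [toSL2R, MonoidHom.comp_apply, toUniversalCover_genT]
  rfl

/-! ### Normal forms from the relation `s t s = t⁻¹ s t⁻¹` -/

section NormalForm

variable {G : Type*} [Group G] {s t : G}

theorem mul_pow_three_eq_sq (h : s * t * s = t⁻¹ * s * t⁻¹) : (t * s) ^ 3 = s ^ 2 :=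
  calc (t * s) ^ 3 = t * (s * t * s) * t * s := by simp only [pow_three, mul_assoc]
    _ = s ^ 2 := by rw [h, sq]; group

theorem commute_sq_of_closure_eq_top (h : s * t * s = t⁻¹ * s * t⁻¹)
    (htop : Subgroup.closure {s, t * s} = ⊤) (g : G) : Commute (s ^ 2) g := by
  have hle : Subgroup.closure {s, t * s} ≤ Subgroup.centralizer {s ^ 2} := by
    rw [Subgroup.closure_le]
    rintro x (rfl | rfl) <;> rw [SetLike.mem_coe, Subgroup.mem_centralizer_singleton_iff]
    · exact (Commute.refl x).pow_right 2
    · rw [← mul_pow_three_eq_sq h]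
      exact (Commute.refl _).pow_right 3
  exact (Subgroup.mem_centralizer_singleton_iff.1 (hle (htop ▸ Subgroup.mem_top g))).symm

variable (s t) in
/-- The submonoid generated by `t = u s⁻¹` and `t s t = u² s⁻¹`, where `u = t s`. -/
def positiveMonoid : Submonoid G := Submonoid.closure {t, t * s * t}

variable (s t) in
/-- The elements `(s ^ 2) ^ k * s ^ ε * w * u ^ j`, where `u = t s`. -/
def IsNormalForm (g : G) : Prop :=
  ∃ k : ℤ, ∃ ε < 2, ∃ w ∈ positiveMonoid s t, ∃ j < 3,
    g = (s ^ 2) ^ k * (s ^ ε * w * (t * s) ^ j)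

theorem IsNormalForm.sq_zpow_mul {g : G} (hg : IsNormalForm s t g) (n : ℤ) :
    IsNormalForm s t ((s ^ 2) ^ n * g) := by
  obtain ⟨k, ε, hε, w, hw, j, hj, rfl⟩ := hg
  exact ⟨n + k, ε, hε, w, hw, j, hj, by rw [zpow_add]; exact (mul_assoc ..).symm⟩

theorem isNormalForm_of_mem_positiveMonoid {w : G} (hw : w ∈ positiveMonoid s t) {j : ℕ}
    (hj : j < 3) : IsNormalForm s t (w * (t * s) ^ j) :=
  ⟨0, 0, by simp, w, hw, j, hj, by simp⟩

theorem IsNormalForm.generator_mul {g : G} (hg : IsNormalForm s t g) : IsNormalForm s t (s * g) := by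
  obtain ⟨k, ε, hε, w, hw, j, hj, rfl⟩ := hg
  have hcomm : s * (s ^ 2) ^ k = (s ^ 2) ^ k * s :=
    (((Commute.refl s).pow_right 2).zpow_right k).eq
  rw [← mul_assoc, hcomm, mul_assoc]
  refine IsNormalForm.sq_zpow_mul ?_ k
  interval_cases ε
  · exact ⟨0, 1, by simp, w, hw, j, hj, by simp [mul_assoc]⟩
  · exact ⟨1, 0, by simp, w, hw, j, hj, by simp [sq, mul_assoc]⟩

theorem IsNormalForm.product_mul (h : s * t * s = t⁻¹ * s * t⁻¹)
    (htop : Subgroup.closure {s, t * s} = ⊤) {g : G} (hg : IsNormalForm s t g) :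
    IsNormalForm s t (t * s * g) := by
  obtain ⟨k, ε, hε, w, hw, j, hj, rfl⟩ := hg
  have hcomm := ((commute_sq_of_closure_eq_top h htop (t * s)).zpow_left k).eq
  rw [← mul_assoc, ← hcomm, mul_assoc]
  refine IsNormalForm.sq_zpow_mul ?_ k
  have ht : t ∈ positiveMonoid s t := Submonoid.subset_closure (by simp)
  have htst : t * s * t ∈ positiveMonoid s t := Submonoid.subset_closure (by simp)
  interval_cases ε
  · rw [pow_zero, one_mul]
    induction hw using Submonoid.closure_induction_left with
    | one =>
      rw [one_mul, ← pow_succ']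
      rcases (Nat.lt_succ_iff.1 hj).lt_or_eq with hj' | rfl
      · simpa using isNormalForm_of_mem_positiveMonoid (one_mem (positiveMonoid s t))
          (Nat.succ_lt_succ hj')
      · rw [mul_pow_three_eq_sq h]
        exact ⟨1, 0, by simp, 1, one_mem _, 0, by simp, by simp⟩
    | mul_left x hx y hy _ =>
      rcases hx with rfl | rfl
      · have := isNormalForm_of_mem_positiveMonoid (mul_mem htst hy) hj
        simpa only [mul_assoc] using this
      · have e : t * s * (t * s * t) = s :=
          calc t * s * (t * s * t) = (t * s) ^ 3 * s⁻¹ := by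
                rw [pow_three, eq_mul_inv_iff_mul_eq]
                simp only [mul_assoc]
            _ = s := by rw [mul_pow_three_eq_sq h, sq, mul_inv_cancel_right]
        rw [← mul_assoc, ← mul_assoc, e, mul_assoc]
        exact (isNormalForm_of_mem_positiveMonoid hy hj).generator_mul
  · have hc := (commute_sq_of_closure_eq_top h htop t).eq
    have e : t * s * (s ^ 1 * w * (t * s) ^ j) =
        (s ^ 2) ^ (1 : ℤ) * (t * w * (t * s) ^ j) := by
      rw [zpow_one, ← mul_assoc _ (t * w), ← mul_assoc _ t, hc]
      simp only [sq, pow_one, mul_assoc]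
    rw [e]
    exact (isNormalForm_of_mem_positiveMonoid (mul_mem ht hw) hj).sq_zpow_mul 1

theorem isNormalForm (h : s * t * s = t⁻¹ * s * t⁻¹)
    (htop : Subgroup.closure {s, t * s} = ⊤) (g : G) : IsNormalForm s t g := by
  have hg : g ∈ Subgroup.closure {s, t * s} := htop ▸ Subgroup.mem_top g
  induction hg using Subgroup.closure_induction_left with
  | one => exact ⟨0, 0, by simp, 1, one_mem _, 0, by simp, by simp⟩
  | mul_left x hx y _ ih =>
    rcases hx with rfl | rfl
    · exact ih.generator_mul
    · exact ih.product_mul h htop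
  | inv_mul_cancel x hx y _ ih =>
    rcases hx with rfl | rfl
    · convert ih.generator_mul.sq_zpow_mul (-1) using 1
      group
    · -- `u⁻¹ = u⁻³ u²` with `u³ = s²`
      convert ((ih.product_mul h htop).product_mul h htop).sq_zpow_mul (-1) using 1
      rw [← mul_pow_three_eq_sq h, zpow_neg_one, pow_three]
      group

end NormalForm

theorem genS_mul_genT_mul_genS : genS * genT * genS = genT⁻¹ * genS * genT⁻¹ :=
  PresentedGroup.mk_eq_mk_of_mul_inv_mem rfl

theorem closure_genS_genT_mul_genS : Subgroup.closure {genS, genT * genS} = ⊤ := by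
  rw [eq_top_iff]
  intro x _
  have hS : genS ∈ Subgroup.closure {genS, genT * genS} :=
    Subgroup.subset_closure (by simp)
  have hT : genT * genS * genS⁻¹ ∈ Subgroup.closure {genS, genT * genS} :=
    mul_mem (Subgroup.subset_closure (by simp)) (inv_mem hS)
  rw [mul_inv_cancel_right] at hT
  refine PresentedGroup.generated_by relatorsG _ (fun j => ?_) x
  cases j
  · exact hS
  · exact hT

/-! ### The kernel of the map to `SL₂(ℝ)` -/

/-- Positive words have nonnegative matrices with positive diagonal, and only the empty word has a
diagonal matrix. -/
theorem toSL2R_positive {w : GroupG} (hw : w ∈ positiveMonoid genS genT) :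
    0 < toSL2R w 0 0 ∧ 0 ≤ toSL2R w 0 1 ∧ 0 ≤ toSL2R w 1 0 ∧ 0 < toSL2R w 1 1 ∧
      (w = 1 ∨ 0 < toSL2R w 0 1 ∨ 0 < toSL2R w 1 0) := by
  induction hw using Submonoid.closure_induction_left with
  | one => simp
  | mul_left x hx y hy ih =>
    obtain ⟨ha, hb, hc, hd, -⟩ := ih
    rcases hx with rfl | rfl
    · simp only [map_mul, toSL2R_genT, specialLinearGroup_mul_apply]
      simp [shearMatrix]
      refine ⟨by linarith, by linarith, hc, hd, Or.inr (Or.inl (by linarith))⟩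
    · simp only [map_mul, toSL2R_genT, toSL2R_genS, specialLinearGroup_mul_apply,
        rotationMatrix_one_apply]
      simp [shearMatrix]
      refine ⟨ha, hb, by linarith, by linarith, Or.inr (Or.inr (by linarith))⟩

theorem toSL2R_genS_sq : toSL2R (genS ^ 2) = -1 := by
  ext i j
  rw [sq, map_mul, toSL2R_genS, specialLinearGroup_mul_apply, rotationMatrix_one_apply]
  fin_cases i <;> fin_cases j <;> simp

theorem exists_eq_genS_sq_zpow {g : GroupG} (hg : toSL2R g = 1) : ∃ k : ℤ, g = (genS ^ 2) ^ k := by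
  obtain ⟨k, ε, hε, w, hw, j, hj, rfl⟩ :=
    isNormalForm genS_mul_genT_mul_genS closure_genS_genT_mul_genS g
  obtain ⟨ha, hb, hc, hd, hw1⟩ := toSL2R_positive hw
  -- `(S ^ 2) ^ k` maps to `±1`, so the remaining factor maps to `±1` and in particular to a
  -- diagonal matrix.
  have hoff : toSL2R (genS ^ ε * w * (genT * genS) ^ j) 0 1 = 0 ∧
      toSL2R (genS ^ ε * w * (genT * genS) ^ j) 1 0 = 0 := by
    rw [map_mul, map_zpow, toSL2R_genS_sq] at hg
    have h := eq_inv_of_mul_eq_one_right hg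
    rw [h]
    rcases k.even_or_odd with hk | hk
    · simp [hk.neg_one_zpow]
    · simp [hk.neg_one_zpow]
  obtain ⟨h1, h2⟩ := hoff
  interval_cases ε <;> interval_cases j <;>
    simp only [map_mul, pow_zero, pow_one, one_mul, mul_one, sq, toSL2R_genS, toSL2R_genT,
      specialLinearGroup_mul_apply, rotationMatrix_one_apply] at h1 h2
  -- For `ε = j = 0` the matrix of `w` is diagonal, so `w` is the empty word; in the other cases
  -- some off-diagonal entry is, up to sign, an entry sum of the
  -- matrix of `w` that includes a diagonal entry, hence nonzero.
  · rcases hw1 with rfl | h | h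
    · exact ⟨k, by simp⟩
    · linarith
    · linarith
  all_goals
    simp [shearMatrix] at h1 h2
    linarith

/-! ### Injectivity and image in the universal cover -/

theorem toUniversalCover_genS_zpow (n : ℤ) : toUniversalCover (genS ^ n) =
    (basedPathsCon SL(2, ℝ)).mk' (rotationPath ^ n) := by
  rw [map_zpow, map_zpow, toUniversalCover_genS]

theorem isLogLift_one : IsLogLift 1 0 :=
  ⟨rfl, fun t => by simp [firstColumn_one]⟩

theorem toUniversalCover_injective : Function.Injective toUniversalCover := by
  rw [injective_iff_map_eq_one]
  intro g hg
  obtain ⟨k, rfl⟩ := exists_eq_genS_sq_zpow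
    (by rw [toSL2R, MonoidHom.comp_apply, hg, map_one] : toSL2R g = 1)
  have e : (genS ^ 2) ^ k = genS ^ (2 * k) := by rw [zpow_mul]; rfl
  rw [e, toUniversalCover_genS_zpow] at hg
  have h : ((rotationPath ^ (2 * k) : basedPaths SL(2, ℝ)) : C(I, SL(2, ℝ))).HomotopicRel 1 {0, 1} :=
    (Con.eq (basedPathsCon SL(2, ℝ))).1 hg
  have := (isLogLift_rotationPath_zpow (2 * k)).apply_one_eq isLogLift_one h
  have hk : k = 0 := by simpa [Real.pi_ne_zero] using this
  simp [hk]

/-- A loop whose logarithm ends at `2 π i m` represents the same class as `S ^ (4 m)`, the rotation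
through `m` full turns. -/
theorem mem_range_of_proj_eq_one {q : UniversalCover SL(2, ℝ)}
    (hq : UniversalCover.proj SL(2, ℝ) q = 1) : q ∈ toUniversalCover.range := by
  obtain ⟨γ, rfl⟩ := Con.mk'_surjective q
  have hγ1 : (γ : C(I, SL(2, ℝ))) 1 = 1 := hq
  obtain ⟨L, hL⟩ := exists_isLogLift γ.2
  obtain ⟨m, hm⟩ := Complex.exp_eq_one_iff.1 ((hL.2 1).trans (by rw [hγ1, firstColumn_one]))
  refine ⟨genS ^ (4 * m), ?_⟩
  rw [toUniversalCover_genS_zpow]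
  have hR := isLogLift_rotationPath_zpow (4 * m)
  have hR1 : ((rotationPath ^ (4 * m) : basedPaths SL(2, ℝ)) : C(I, SL(2, ℝ))) 1 = 1 := by
    have h4 : rotationMatrix 4 = 1 := by
      have : Real.pi * 4 / 2 = 2 * Real.pi := by ring
      ext i j
      fin_cases i <;> fin_cases j <;> simp [rotationMatrix, this]
    have := rotationMatrix_zpow 4 m
    rw [h4, one_zpow] at this
    rw [rotationPath_zpow_apply, this]
    push_cast
    congr 1
    simp [mul_comm]
  refine (Con.eq (basedPathsCon SL(2, ℝ))).2 (hR.homotopicRel hL ?_ (hR1.trans hγ1.symm) ?_)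
  · exact (Subtype.property (rotationPath ^ (4 * m))).trans γ.2.symm
  · rw [hm]
    simp
    ring

theorem range_toSL2R : toSL2R.range =
    (Matrix.SpecialLinearGroup.map (n := Fin 2) (Int.castRingHom ℝ)).range := by
  have hS : Matrix.SpecialLinearGroup.map (Int.castRingHom ℝ) ModularGroup.S = toSL2R genS := by
    ext i j
    rw [toSL2R_genS, rotationMatrix_one_apply]
    rw [Matrix.SpecialLinearGroup.map_apply_coe, RingHom.mapMatrix_apply, Matrix.map_apply]
    fin_cases i <;> fin_cases j <;> simp [ModularGroup.S]
  have hT : Matrix.SpecialLinearGroup.map (Int.castRingHom ℝ) ModularGroup.T = toSL2R genT := by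
    ext i j
    rw [toSL2R_genT]
    rw [Matrix.SpecialLinearGroup.map_apply_coe, RingHom.mapMatrix_apply, Matrix.map_apply]
    fin_cases i <;> fin_cases j <;> simp [ModularGroup.T, shearMatrix]
  rw [MonoidHom.range_eq_map, MonoidHom.range_eq_map, ← PresentedGroup.closure_range_of,
    ← SpecialLinearGroup.SL2Z_generators, MonoidHom.map_closure, MonoidHom.map_closure,
    Set.image_pair, hS, hT]
  congr 1
  ext x
  constructor
  · rintro ⟨_, ⟨j, rfl⟩, rfl⟩
    cases j
    · exact Or.inl rfl
    · exact Or.inr rfl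
  · rintro (rfl | rfl)
    · exact ⟨_, ⟨Gen.S, rfl⟩, rfl⟩
    · exact ⟨_, ⟨Gen.T, rfl⟩, rfl⟩

theorem range_toUniversalCover : toUniversalCover.range = preimageSL2Z := by
  ext q
  rw [preimageSL2Z, ← range_toSL2R, Subgroup.mem_comap]
  constructor
  · rintro ⟨g, rfl⟩
    exact ⟨g, rfl⟩
  · rintro ⟨g, hg⟩
    have h : UniversalCover.proj SL(2, ℝ) ((toUniversalCover g)⁻¹ * q) = 1 := by
      rw [map_mul, map_inv, ← hg]
      exact inv_mul_cancel _
    have := mul_mem (⟨g, rfl⟩ : toUniversalCover g ∈ toUniversalCover.range)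
      (mem_range_of_proj_eq_one h)
    rwa [mul_inv_cancel_left] at this

theorem mainTheorem6 :
    ∃ φ : GroupG ≃* preimageSL2Z,
      (φ (PresentedGroup.of Gen.S) : UniversalCover SL(2, ℝ)) =
          (basedPathsCon SL(2, ℝ)).mk' rotationPath ∧
        (φ (PresentedGroup.of Gen.T) : UniversalCover SL(2, ℝ)) =
          (basedPathsCon SL(2, ℝ)).mk' shearPath :=
  ⟨(MonoidHom.ofInjective toUniversalCover_injective).trans
      (MulEquiv.subgroupCongr range_toUniversalCover),
    toUniversalCover_genS, toUniversalCover_genT⟩
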